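/- Let $L$ be a real quadratic field, regarded as a subfield of $\mathbb{R}$, with ring of integers $\mathcal{O}_L$, and let $\eta>1$ be its fundamental unit, so that $\mathcal{O}_L^\times=\{\pm\eta^m : m\in\mathbb{Z}\}$. Let $k\geq 1$ be an integer and put $\rho:=\lfloor k/2\rfloor$. For real $X\geq 2$ let $N_{L,k}(X)$ be the number of integers $n\in\mathbb{Z}$ with $|n|\leq X$ such that $n=u_1+\cdots+u_r$ for some integer $0\leq r\leq k$ and some units $u_1,\ldots,u_r\in\mathcal{O}_L^\times$ (repetitions are allowed, and the empty sum, $r=0$, is $0$). Then, for all $X\geq 2$, $$N_{L,k}(X)=c_k\left(\frac{2\log X}{\log\eta}\right)^{\rho}+O_{k,L}\left((\log X)^{\rho-1}\right),$$ where $c_k=1/\rho!$ if $k$ is even and $c_k=3/\rho!$ if $k$ is odd. That is, there is a constant $C$ depending only on $k$ and $L$ such that the difference between $N_{L,k}(X)$ and the main term is at most $C(\log X)^{\rho-1}$ in absolute value for all $X\geq 2$. -/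

import Mathlib

open scoped NumberField Nat

namespace SumsOfUnits

/-- `η` is a fundamental unit of `L`: every unit of the ring of integers of `L` is `η ^ n` or
`-η ^ n` for some integer `n`. (A field with a real embedding has `1` and `-1` as its only roots
of unity. A real embedding with `1 < σ η` then determines `η` uniquely.) -/
def IsFundamentalUnit {L : Type*} [Field L] [NumberField L] (η : (𝓞 L)ˣ) : Prop :=
  ∀ u : (𝓞 L)ˣ, ∃ n : ℤ, u = η ^ n ∨ u = -η ^ n

/-- The set of rational integers that are sums of at most `k` units of the ring of integers of
`L`; the empty sum is `0`. -/
def unitSums (L : Type*) [Field L] [NumberField L] (k : ℕ) : Set ℤ :=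
  {n | ∃ r : ℕ, r ≤ k ∧ ∃ u : Fin r → (𝓞 L)ˣ, (n : 𝓞 L) = ∑ i, (u i : 𝓞 L)}

/-- The number of integers `n` with `|n| ≤ X` that are sums of at most `k` units. -/
noncomputable def countUnitSums (L : Type*) [Field L] [NumberField L] (k : ℕ) (X : ℝ) : ℕ :=
  {n : ℤ | n ∈ unitSums L k ∧ |(n : ℝ)| ≤ X}.ncard

/-- The leading constant: `1 / ρ!` for even `k` and `3 / ρ!` for odd `k`, with `ρ = ⌊k / 2⌋`. -/
noncomputable def leadingConst (k : ℕ) : ℝ :=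
  if Even k then 1 / ((k / 2)! : ℝ) else 3 / ((k / 2)! : ℝ)

end SumsOfUnits

/-! Write x = `f η` and let τ be conjugation. Suppose n is a rational sum of at most k units ±η^e,
taken with as few units as possible, and let m be the largest |e|. Nonzero short sums of the η^(-b)
with b ≤ G are finitely many, hence bounded away from 0. By pigeonhole there is a window of |e| just
below m followed by a long gap. Comparing n with τ n across this gap forces the window terms of
nonnegative exponent to sum to some T, and those of negative exponent to sum exactly to τ T
(`window_conj`). Minimality gives T ≠ 0, so n is the trace of T plus a much smaller sum of the
remaining units.

If T is itself ± a power η^a, two units suffice for its trace, and the remainder is O(x^a).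
Otherwise at least four units are used up, while T = η^m z with z in a fixed finite set
(`exists_decomposition`). Conversely, the integers ±Tr η^a + n' with |n'| ≤ x^a / D are distinct for
distinct (±, a). With N_k the counting function, this gives N_{k+2}(X) = 2 ∑_a N_k(≍ x^a) + O(log X
· N_{k-2}(BX)), summed over x^a up to a constant multiple of X (`exists_card_le`, `exists_le_card`).
The last term is one logarithm below the main term. Since ∑_{a<l} 2 c (2a)^p ≈ c (2l)^(p+1)/(p+1),
induction from N_0 = 1 and N_1 = 3 yields the constants 1/ρ! and 3/ρ!. -/

namespace SumsOfUnits

/-! ### Signed powers of the fundamental unit, conjugation, and gaps between short sums -/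

section Conjugation

variable {R : Type*} [CommRing R]

/-- The data used about a real quadratic ring: a real embedding `f`, the conjugation `τ` and a
fundamental unit `η` with `1 < f η`. -/
structure IsRealConj (f : R →+* ℝ) (τ : R →+* R) (η : Rˣ) : Prop where
  inj : Function.Injective f
  one_lt : 1 < f η
  exists_zpow : ∀ u : Rˣ, ∃ n : ℤ, u = η ^ n ∨ u = -η ^ n
  invol : ∀ z, τ (τ z) = z
  fixed : ∀ z, τ z = z → ∃ n : ℤ, (n : R) = z
  norm : (η : R) * τ η = 1 ∨ (η : R) * τ η = -1

/-- `z` is `η ^ a` or `-η ^ a`. -/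
def IsSignedPow (η : Rˣ) (a : ℤ) (z : R) : Prop :=
  z = ((η ^ a : Rˣ) : R) ∨ z = -((η ^ a : Rˣ) : R)

/-- The rational integers that are sums of at most `k` units of `R`. -/
def sumsOfUnits (R : Type*) [CommRing R] (k : ℕ) : Set ℤ :=
  {n | ∃ r : ℕ, r ≤ k ∧ ∃ u : Fin r → Rˣ, (n : R) = ∑ i, (u i : R)}

variable {f : R →+* ℝ} {τ : R →+* R} {η : Rˣ}

namespace IsSignedPow

variable {a b : ℤ} {z : R}

theorem neg (h : IsSignedPow η a z) : IsSignedPow η a (-z) := by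
  rcases h with h | h <;> simp [IsSignedPow, h]

theorem zpow_mul (h : IsSignedPow η a z) (b : ℤ) :
    IsSignedPow η (b + a) (((η ^ b : Rˣ) : R) * z) := by
  rcases h with h | h <;> simp [IsSignedPow, h, zpow_add]

theorem map_zpow_unit (f : R →+* ℝ) (a : ℤ) : f ((η ^ a : Rˣ) : R) = f η ^ a := by
  have := congrArg Units.val (map_zpow (Units.map (f : R →* ℝ)) η a)
  rwa [Units.val_zpow_eq_zpow_val] at this

theorem abs_map (h : IsSignedPow η a z) (hη : 0 < f η) : |f z| = f η ^ a := by
  have : 0 < f η ^ a := zpow_pos hη a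
  rcases h with h | h <;> simp [h, map_zpow_unit, abs_of_pos hη]

theorem mk_unit {u : Rˣ} (h : u = η ^ a ∨ u = -η ^ a) : IsSignedPow η a (u : R) := by
  rcases h with rfl | rfl <;> simp [IsSignedPow]

end IsSignedPow

namespace IsRealConj

theorem pos (h : IsRealConj f τ η) : 0 < f η := one_pos.trans h.one_lt

/-- Norm ±1 means τ η = ±η⁻¹. The sign is irrelevant for everything that follows, which is why
signed powers are used. -/
theorem isSignedPow_conj_unit (h : IsRealConj f τ η) (a : ℤ) :
    IsSignedPow η (-a) (τ ((η ^ a : Rˣ) : R)) := by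
  have key : Units.map (τ : R →* R) η = η⁻¹ ∨ Units.map (τ : R →* R) η = -η⁻¹ := by
    rcases h.norm with h1 | h1
    · left
      rw [eq_comm, inv_eq_iff_mul_eq_one]
      ext; simpa using h1
    · right
      rw [eq_comm, ← inv_neg, inv_eq_iff_mul_eq_one]
      ext; simp [h1]
  have e : τ ((η ^ a : Rˣ) : R) = ((Units.map (τ : R →* R) η ^ a : Rˣ) : R) := by
    rw [← map_zpow]; rfl
  rw [e]
  rcases key with h1 | h1
  · rw [h1]; left; simp
  · rw [h1]
    rcases Int.even_or_odd a with ha | ha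
    · left; simp [ha.neg_zpow]
    · right; simp [ha.neg_zpow]

theorem isSignedPow_conj (h : IsRealConj f τ η) {a : ℤ} {z : R} (hz : IsSignedPow η a z) :
    IsSignedPow η (-a) (τ z) := by
  rcases hz with rfl | rfl
  · exact h.isSignedPow_conj_unit a
  · rw [map_neg]; exact (h.isSignedPow_conj_unit a).neg

theorem exists_trace (h : IsRealConj f τ η) (z : R) : ∃ n : ℤ, (n : R) = z + τ z :=
  h.fixed _ (by rw [map_add, h.invol, add_comm])

theorem exists_unit_of_isSignedPow {a : ℤ} {z : R} (hz : IsSignedPow η a z) : ∃ u : Rˣ, (u : R) = z := by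
  rcases hz with h | h
  · exact ⟨η ^ a, h.symm⟩
  · exact ⟨-η ^ a, by simp [h]⟩

end IsRealConj

theorem mem_sumsOfUnits_of_finset {ι : Type*} {k : ℕ} {n : ℤ} (s : Finset ι) (u : ι → Rˣ)
    (hs : s.card ≤ k) (hn : (n : R) = ∑ i ∈ s, (u i : R)) : n ∈ sumsOfUnits R k := by
  refine ⟨s.card, hs, fun i => u (s.equivFin.symm i), ?_⟩
  rw [hn, ← Finset.sum_coe_sort s, ← Equiv.sum_comp s.equivFin.symm]

theorem add_mem_sumsOfUnits {k l : ℕ} {m n : ℤ} (hm : m ∈ sumsOfUnits R k)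
    (hn : n ∈ sumsOfUnits R l) : m + n ∈ sumsOfUnits R (k + l) := by
  obtain ⟨r, hr, u, hu⟩ := hm
  obtain ⟨s, hs, v, hv⟩ := hn
  refine ⟨r + s, by omega, Fin.append u v, ?_⟩
  rw [Fin.sum_univ_add]
  simp [hu, hv]

/-- The sums of at most `k` elements of a finite set form a finite set. -/
theorem exists_finset_sum_mem (V : Finset R) (k : ℕ) :
    ∃ Z : Finset R, ∀ (ι : Type) (s : Finset ι) (v : ι → R), s.card ≤ k →
      (∀ i ∈ s, v i ∈ V) → ∑ i ∈ s, v i ∈ Z := by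
  classical
  induction k with
  | zero =>
    refine ⟨{0}, fun ι s v hs _ => ?_⟩
    rw [Finset.card_eq_zero.1 (Nat.le_zero.1 hs)]; simp
  | succ k ih =>
    obtain ⟨Z, hZ⟩ := ih
    refine ⟨Z ∪ (V ×ˢ Z).image (fun p => p.1 + p.2), fun ι s v hs hv => ?_⟩
    rcases s.eq_empty_or_nonempty with rfl | ⟨i, hi⟩
    · exact Finset.mem_union_left _ (hZ ι ∅ v (by simp) (by simp))
    · refine Finset.mem_union_right _ (Finset.mem_image.2 ⟨(v i, ∑ j ∈ s.erase i, v j), ?_, ?_⟩)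
      · refine Finset.mem_product.2 ⟨hv i hi, hZ ι _ v ?_ fun j hj => hv j (Finset.mem_of_mem_erase hj)⟩
        rw [Finset.card_erase_of_mem hi]; omega
      · exact Finset.add_sum_erase s v hi

/-- Sums of at most `k` signed powers `±η ^ (-b)` with `b ≤ G` form a finite set. -/
theorem exists_finset_short_sum (η : Rˣ) (k G : ℕ) :
    ∃ Z : Finset R, ∀ (ι : Type) (s : Finset ι) (v : ι → R), s.card ≤ k →
      (∀ i ∈ s, ∃ b : ℕ, b ≤ G ∧ IsSignedPow η (-(b : ℤ)) (v i)) → ∑ i ∈ s, v i ∈ Z := by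
  classical
  obtain ⟨Z, hZ⟩ := exists_finset_sum_mem
    ((Finset.range (G + 1)).image (fun b : ℕ => ((η ^ (-(b : ℤ)) : Rˣ) : R)) ∪
      (Finset.range (G + 1)).image (fun b : ℕ => -((η ^ (-(b : ℤ)) : Rˣ) : R))) k
  refine ⟨Z, fun ι s v hs hv => hZ ι s v hs fun i hi => ?_⟩
  obtain ⟨b, hb, h | h⟩ := hv i hi
  · exact Finset.mem_union_left _ (Finset.mem_image.2 ⟨b, by simp; omega, h.symm⟩)
  · exact Finset.mem_union_right _ (Finset.mem_image.2 ⟨b, by simp; omega, h.symm⟩)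

/-- Nonzero short sums are bounded away from zero. -/
theorem IsRealConj.exists_gap (h : IsRealConj f τ η) (k G : ℕ) :
    ∃ G' : ℕ, G ≤ G' ∧ ∀ (ι : Type) (s : Finset ι) (v : ι → R), s.card ≤ k →
      (∀ i ∈ s, ∃ b : ℕ, b ≤ G ∧ IsSignedPow η (-(b : ℤ)) (v i)) → ∑ i ∈ s, v i ≠ 0 →
        6 * (k : ℝ) ≤ f η ^ G' * |f (∑ i ∈ s, v i)| := by
  obtain ⟨Z, hZ⟩ := exists_finset_short_sum η k G
  have key : ∀ Y : Finset R, ∃ G' : ℕ, G ≤ G' ∧ ∀ z ∈ Y, z ≠ 0 → 6 * (k : ℝ) ≤ f η ^ G' * |f z| := by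
    classical
    intro Y
    induction Y using Finset.induction_on with
    | empty => exact ⟨G, le_rfl, by simp⟩
    | insert y Y hy ih =>
      obtain ⟨G', hG, hY⟩ := ih
      have mono : ∀ {G1 G2 : ℕ} (z : R), G1 ≤ G2 → 6 * (k : ℝ) ≤ f η ^ G1 * |f z| →
          6 * (k : ℝ) ≤ f η ^ G2 * |f z| := fun z h12 hz =>
        hz.trans (mul_le_mul_of_nonneg_right (pow_le_pow_right₀ h.one_lt.le h12) (abs_nonneg _))
      by_cases hy0 : y = 0
      · refine ⟨G', hG, fun z hz hz0 => hY z ?_ hz0⟩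
        rcases Finset.mem_insert.1 hz with rfl | hz
        · exact absurd hy0 hz0
        · exact hz
      · have hpos : 0 < |f y| := abs_pos.2 fun h0 => hy0 (h.inj (by simpa using h0))
        obtain ⟨N, hN⟩ := pow_unbounded_of_one_lt (6 * (k : ℝ) / |f y|) h.one_lt
        refine ⟨max G' N, hG.trans (le_max_left _ _), fun z hz hz0 => ?_⟩
        rcases Finset.mem_insert.1 hz with rfl | hz
        · exact mono z (le_max_right _ _) ((div_lt_iff₀ hpos).1 hN).le
        · exact mono z (le_max_left _ _) (hY z hz hz0)
  obtain ⟨G', hG, h'⟩ := key Z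
  exact ⟨G', hG, fun ι s v hs hv h0 => h' _ (hZ ι s v hs hv) h0⟩

/-- Along a monotone sequence of thresholds one of the first `r` windows below the maximum
contains no value. -/
theorem exists_stationary_window {r : ℕ} (hgt : Fin r → ℕ) (m : ℕ) (hm : ∃ i, hgt i = m)
    (G : ℕ → ℕ) (hG : Monotone G) :
    ∃ j < r, ∀ i, m ≤ hgt i + G (j + 1) → m ≤ hgt i + G j := by
  classical
  by_contra! hcon
  -- If every window failed, each enlargement would capture a new index, giving r + 1 indices among
  -- r.
  have key : ∀ j ≤ r, j + 1 ≤ (Finset.univ.filter fun i => m ≤ hgt i + G j).card := by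
    intro j
    induction j with
    | zero =>
      intro _
      obtain ⟨i, hi⟩ := hm
      exact Finset.card_pos.2 ⟨i, by simp; omega⟩
    | succ j ih =>
      intro hj
      obtain ⟨i, hi1, hi2⟩ := hcon j (by omega)
      have := Finset.card_lt_card (s := Finset.univ.filter fun i => m ≤ hgt i + G j)
        (t := Finset.univ.filter fun i => m ≤ hgt i + G (j + 1)) ?_
      · have := ih (by omega); omega
      · refine Finset.ssubset_iff_subset_ne.2 ⟨fun l hl => ?_, fun he => ?_⟩
        · have := hG (Nat.le_succ j)
          simp only [Finset.mem_filter, Finset.mem_univ, true_and] at hl ⊢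
          simp only [Nat.succ_eq_add_one] at this
          omega
        · have : i ∈ Finset.univ.filter fun i => m ≤ hgt i + G j := by rw [he]; simpa using hi1
          simp at this; omega
  have h1 := key r le_rfl
  have h2 := Finset.card_le_univ (Finset.univ.filter fun i => m ≤ hgt i + G r)
  simp at h2
  omega

end Conjugation
-- Splitting a trace off a rational sum of units
section Decomposition

variable {R : Type*} [CommRing R] {f : R →+* ℝ} {τ : R →+* R} {η : Rˣ}

theorem abs_map_sum_le {ι : Type*} (f : R →+* ℝ) (s : Finset ι) (v : ι → R) (C : ℝ)
    (hv : ∀ i ∈ s, |f (v i)| ≤ C) : |f (∑ i ∈ s, v i)| ≤ s.card * C := by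
  rw [map_sum]
  exact (Finset.abs_sum_le_sum_abs _ _).trans
    ((Finset.sum_le_card_nsmul s _ C hv).trans (by simp))

/-- Stated for a general monoid so that it splits both the sum of units and, with constant summand
1, the number of units. -/
theorem sum_eq_window_add {M : Type*} [AddCommMonoid M] {r : ℕ} (p q : Fin r → Prop)
    [DecidablePred p] [DecidablePred q] (v : Fin r → M) :
    ∑ i, v i = ∑ i with p i ∧ q i, v i + ∑ i with p i ∧ ¬ q i, v i + ∑ i with ¬ p i, v i := by
  rw [← Finset.filter_filter, ← Finset.filter_filter, Finset.sum_filter_add_sum_filter_not,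
    Finset.sum_filter_add_sum_filter_not]

/-- If the exponents of a unit sum with rational value have a large gap below the window
`[m - G, m]` of absolute values, the positive and the negative part of the window are conjugate. -/
theorem IsRealConj.window_conj (h : IsRealConj f τ η) {k r : ℕ} (hr : r ≤ k) (hk : 0 < k)
    (u : Fin r → Rˣ) (e : Fin r → ℤ) (he : ∀ i, IsSignedPow η (e i) (u i : R)) (n : ℤ)
    (hn : (n : R) = ∑ i, (u i : R)) (m G G' : ℕ) (hm : ∀ i, (e i).natAbs ≤ m)
    (hmG : G' ≤ m) (hwin : ∀ i, m ≤ (e i).natAbs + G' → m ≤ (e i).natAbs + G)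
    (hgap : ∀ (ι : Type) (s : Finset ι) (v : ι → R), s.card ≤ k →
      (∀ i ∈ s, ∃ b : ℕ, b ≤ G ∧ IsSignedPow η (-(b : ℤ)) (v i)) → ∑ i ∈ s, v i ≠ 0 →
        6 * (k : ℝ) ≤ f η ^ G' * |f (∑ i ∈ s, v i)|) :
    ∑ i with m ≤ (e i).natAbs + G ∧ 0 ≤ e i, (u i : R) =
      τ (∑ i with m ≤ (e i).natAbs + G ∧ ¬ 0 ≤ e i, (u i : R)) := by
  have hx := h.one_lt
  have hx0 := h.pos
  set x := f η with hxdef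
  rw [← sub_eq_zero]
  by_contra hW
  set W := ∑ i with m ≤ (e i).natAbs + G ∧ 0 ≤ e i, (u i : R) -
      τ (∑ i with m ≤ (e i).natAbs + G ∧ ¬ 0 ≤ e i, (u i : R)) with hWdef
  have hcard : ∀ s : Finset (Fin r), s.card ≤ k := fun s => by
    simpa using (Finset.card_le_univ s).trans (by simpa using hr)
  -- Conjugating the negative exponents turns W into a sum of signed powers with exponents |e i|.
  -- Scaled by η^(-m), it is a short sum to which the gap hypothesis applies.
  let w : Fin r → R := fun i => if 0 ≤ e i then (u i : R) else -τ (u i)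
  have hW1 : W = ∑ i with m ≤ (e i).natAbs + G, w i := by
    rw [hWdef, ← Finset.filter_filter, ← Finset.filter_filter, map_sum, sub_eq_add_neg,
      ← Finset.sum_neg_distrib, ← Finset.sum_ite]
  have hw : ∀ i, IsSignedPow η ((e i).natAbs : ℤ) (w i) := by
    intro i
    by_cases hi : 0 ≤ e i
    · have : ((e i).natAbs : ℤ) = e i := by omega
      simp only [w, if_pos hi, this]; exact he i
    · have : ((e i).natAbs : ℤ) = -e i := by omega
      simp only [w, if_neg hi, this]; exact (h.isSignedPow_conj (he i)).neg
  have hlow : 6 * (k : ℝ) ≤ x ^ G' * |f (((η ^ (-(m : ℤ)) : Rˣ) : R) * W)| := by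
    rw [hW1, Finset.mul_sum]
    refine hgap (Fin r) _ (fun i => ((η ^ (-(m : ℤ)) : Rˣ) : R) * w i) (hcard _) ?_ ?_
    · intro i hi
      refine ⟨m - (e i).natAbs, ?_, ?_⟩
      · simp at hi; omega
      · have := (hw i).zpow_mul (-(m : ℤ))
        have h2 : -((m - (e i).natAbs : ℕ) : ℤ) = -(m : ℤ) + ((e i).natAbs : ℤ) := by
          have := hm i; omega
        rwa [h2]
    · rw [← Finset.mul_sum, ← hW1]
      exact (Units.mul_right_eq_zero _).not.2 hW
  have hup : |f W| ≤ 3 * k * x ^ (m - G') := by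
    -- Adding τ n - n = 0 to W replaces each window term by its conjugate up to sign, of nonpositive
    -- exponent, so of absolute value at most 1. Terms outside the window contribute at most 2
    -- x^(m-G'). The resulting bound 3k x^(m-G') contradicts the lower bound 6k x^(m-G').
    let v : Fin r → R := fun i =>
      if m ≤ (e i).natAbs + G then (if 0 ≤ e i then τ (u i) else -(u i : R))
      else τ (u i) - u i
    have hW2 : W = ∑ i, v i := by
      have h1 : τ (∑ i, (u i : R)) = ∑ i, (u i : R) := by rw [← hn]; simp
      have h2 : ∑ i, (if m ≤ (e i).natAbs + G then w i else 0) = W := by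
        rw [hW1, Finset.sum_filter]
      rw [← sub_eq_zero, map_sum, ← Finset.sum_sub_distrib] at h1
      have h3 : W = W + ∑ i, (τ (u i : R) - (u i : R)) := by rw [h1, add_zero]
      rw [h3, ← h2, ← Finset.sum_add_distrib]
      refine Finset.sum_congr rfl fun i _ => ?_
      simp only [w, v]
      split_ifs <;> ring
    have hY : 1 ≤ x ^ (m - G') := one_le_pow₀ hx.le
    have hv : ∀ i, |f (v i)| ≤ 3 * x ^ (m - G') := by
      intro i
      have hu := (he i).abs_map hx0
      have ht := (h.isSignedPow_conj (he i)).abs_map hx0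
      have hneg : ∀ a : ℤ, a ≤ 0 → x ^ a ≤ x ^ (m - G') := fun a ha => by
        rw [← zpow_natCast]; exact zpow_le_zpow_right₀ hx.le (by omega)
      simp only [v]
      split_ifs with h1 h2
      · rw [ht]; have := hneg (-e i) (by omega); linarith
      · rw [map_neg, abs_neg, hu]; have := hneg (e i) (by omega); linarith
      · have h3 : (e i).natAbs + G' < m := by
          by_contra hc; exact h1 (hwin i (by omega))
        have hle : ∀ a : ℤ, a ≤ (e i).natAbs → x ^ a ≤ x ^ (m - G') := fun a ha => by
          rw [← zpow_natCast]; exact zpow_le_zpow_right₀ hx.le (by omega)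
        rw [map_sub]
        refine (abs_sub _ _).trans ?_
        rw [ht, hu]
        have := hle (-e i) (by omega); have := hle (e i) (by omega); linarith
    rw [hW2]
    refine (abs_map_sum_le f _ v _ fun i _ => hv i).trans ?_
    have : ((Finset.univ : Finset (Fin r)).card : ℝ) ≤ k := by exact_mod_cast hcard _
    nlinarith
  rw [map_mul, abs_mul, IsSignedPow.map_zpow_unit, ← hxdef, abs_of_pos (zpow_pos hx0 _), zpow_neg,
    zpow_natCast] at hlow
  have hxm : x ^ m = x ^ G' * x ^ (m - G') := by rw [← pow_add]; congr 1; omega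
  have hk' : (0 : ℝ) < k := by exact_mod_cast hk
  have hG0 : 0 < x ^ G' := pow_pos hx0 _
  have hY0 : 0 < x ^ (m - G') := pow_pos hx0 _
  have : x ^ G' * ((x ^ m)⁻¹ * |f W|) = |f W| / x ^ (m - G') := by
    rw [hxm]; field_simp
  rw [this, le_div_iff₀ hY0] at hlow
  nlinarith

theorem abs_intCast_eq (f : R →+* ℝ) (n : ℤ) : |(n : ℝ)| = |f (n : R)| := by simp

/-- A large rational sum of `k` units is the trace of a unit plus a sum of `k - 2` units, or the
trace of an element from a sparse set plus a sum of `k - 4` units. -/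
theorem IsRealConj.exists_decomposition (h : IsRealConj f τ η) (k : ℕ) :
    ∃ (B : ℝ) (Z : Finset R), 2 ≤ B ∧ ∀ n ∈ sumsOfUnits R k, |(n : ℝ)| ≤ B ∨
      (∃ (a : ℕ) (z : R) (t n' : ℤ), 2 ≤ k ∧ IsSignedPow η a z ∧ (t : R) = z + τ z ∧ n = t + n' ∧
        n' ∈ sumsOfUnits R (k - 2) ∧ |(n' : ℝ)| ≤ B * f η ^ a ∧ f η ^ a ≤ B * |(n : ℝ)|) ∨
      (∃ (m : ℕ) (z : R) (t n' : ℤ), 4 ≤ k ∧ z ∈ Z ∧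
        (t : R) = ((η ^ m : Rˣ) : R) * z + τ (((η ^ m : Rˣ) : R) * z) ∧ n = t + n' ∧
        n' ∈ sumsOfUnits R (k - 4) ∧ |(n' : ℝ)| ≤ B * |(n : ℝ)| ∧ f η ^ m ≤ B * |(n : ℝ)|) := by
  classical
  have hx := h.one_lt
  have hx0 := h.pos
  rcases Nat.eq_zero_or_pos k with rfl | hk
  · refine ⟨2, ∅, le_rfl, fun n hn => Or.inl ?_⟩
    obtain ⟨r, hr, u, hu⟩ := hn
    obtain rfl := Nat.le_zero.1 hr
    rw [abs_intCast_eq f, hu]; simp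
  choose g hg1 hg2 using h.exists_gap k
  -- Each threshold is the gap exponent of the previous one, so an empty range of heights between
  -- consecutive thresholds is long enough for `window_conj`.
  let G : ℕ → ℕ := fun j => g^[j] 0
  have hGs : ∀ j, G (j + 1) = g (G j) := fun j => Function.iterate_succ_apply' g j 0
  have hG : Monotone G := monotone_nat_of_le_succ fun j => by rw [hGs]; exact hg1 _
  obtain ⟨Z, hZ⟩ := exists_finset_short_sum η k (G k)
  have hΓ : 1 ≤ f η ^ G k := one_le_pow₀ hx.le
  have hk1 : (1 : ℝ) ≤ k := by exact_mod_cast hk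
  refine ⟨k * f η ^ G k + 2, Z, by nlinarith, fun n hn => ?_⟩
  set x := f η with hxdef
  set B := (k : ℝ) * x ^ G k + 2 with hB
  -- A representation of minimal length is chosen; otherwise the window could cancel and T could
  -- vanish.
  have hex : ∃ r, ∃ u : Fin r → Rˣ, (n : R) = ∑ i, (u i : R) := by
    obtain ⟨r, _, u, hu⟩ := hn; exact ⟨r, u, hu⟩
  obtain ⟨u, hu⟩ := Nat.find_spec hex
  have hmin : ∀ s : Finset (Fin (Nat.find hex)), (n : R) = ∑ i ∈ s, (u i : R) →
      Nat.find hex ≤ s.card := by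
    intro s hs
    obtain ⟨r, hr, v, hv⟩ := mem_sumsOfUnits_of_finset s u le_rfl hs
    exact (Nat.find_min' hex ⟨v, hv⟩).trans hr
  have hr : Nat.find hex ≤ k := by
    obtain ⟨r, hr, v, hv⟩ := hn
    exact (Nat.find_min' hex ⟨v, hv⟩).trans hr
  generalize Nat.find hex = r at u hu hmin hr
  have hcard : ∀ s : Finset (Fin r), (s.card : ℝ) ≤ k := fun s => by
    have : s.card ≤ k := (Finset.card_le_univ s).trans (by simpa using hr)
    exact_mod_cast this
  have hexp : ∀ i, ∃ a, IsSignedPow η a (u i : R) := fun i => by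
    obtain ⟨a, ha⟩ := h.exists_zpow (u i)
    exact ⟨a, IsSignedPow.mk_unit ha⟩
  choose e he using hexp
  have habs : ∀ i, |f (u i)| = x ^ e i := fun i => (he i).abs_map hx0
  -- Bounded exponents give bounded n. Otherwise m exceeds every threshold in use, as `window_conj`
  -- requires.
  by_cases hlarge : ∀ i, (e i).natAbs ≤ G k
  · left
    rw [abs_intCast_eq f, hu]
    refine (abs_map_sum_le f _ _ (x ^ G k) fun i _ => ?_).trans ?_
    · rw [habs, ← zpow_natCast]
      have := hlarge i
      exact zpow_le_zpow_right₀ hx.le (by omega)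
    · have := hcard Finset.univ
      nlinarith
  right
  push Not at hlarge
  obtain ⟨i₀, hi₀⟩ := hlarge
  obtain ⟨i₁, -, hi₁⟩ := Finset.exists_max_image Finset.univ (fun i => (e i).natAbs) ⟨i₀, by simp⟩
  obtain ⟨m, hm⟩ : ∃ m, m = (e i₁).natAbs := ⟨_, rfl⟩
  have hmax : ∀ i, (e i).natAbs ≤ m := fun i => hm ▸ hi₁ i (Finset.mem_univ i)
  obtain ⟨j, hj, hwin⟩ := exists_stationary_window (fun i => (e i).natAbs) m ⟨i₁, hm.symm⟩ G hG
  have hjk : G (j + 1) ≤ G k := hG (by omega)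
  have hjj : G j ≤ G (j + 1) := hG (by omega)
  have hmG : G (j + 1) ≤ m := by have := hmax i₀; omega
  have hgap := hg2 (G j)
  rw [← hGs] at hgap
  have hconj := h.window_conj hr hk u e he n hu m (G j) (G (j + 1)) hmax hmG hwin hgap
  have hsplit := sum_eq_window_add (fun i => m ≤ (e i).natAbs + G j) (fun i => 0 ≤ e i)
    (fun i => (u i : R))
  have hsplitc := sum_eq_window_add (fun i => m ≤ (e i).natAbs + G j) (fun i => 0 ≤ e i)
    (fun _ => 1)
  simp only [← Finset.card_eq_sum_ones, Finset.card_univ, Fintype.card_fin] at hsplitc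
  rw [← hu] at hsplit
  set P := Finset.univ.filter fun i => m ≤ (e i).natAbs + G j ∧ 0 ≤ e i with hP
  set Q := Finset.univ.filter fun i => m ≤ (e i).natAbs + G j ∧ ¬ 0 ≤ e i with hQ
  set S := Finset.univ.filter fun i => ¬ m ≤ (e i).natAbs + G j with hS
  set T := ∑ i ∈ P, (u i : R) with hT
  have hconj' : ∑ i ∈ Q, (u i : R) = τ T := by rw [hconj, h.invol]
  rw [hconj'] at hsplit
  have hT0 : T ≠ 0 := by
    intro hT0
    rw [hT0] at hsplit
    -- With T = 0 the units outside the window already sum to n, so by minimality they are all the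
    -- units; but the one of maximal height lies in the window.
    have h1 := hmin S (by simpa using hsplit)
    have h2 : S.card ≤ r := by simpa using Finset.card_le_univ S
    have : i₁ ∈ S := by
      rw [Finset.eq_univ_of_card S (by simpa using le_antisymm h2 h1)]
      simp
    simp [hS] at this
    omega
  have hPpos : 0 < P.card := Finset.card_pos.2 <| Finset.nonempty_iff_ne_empty.2 fun hc => by
    simp [hT, hc] at hT0
  have hQpos : 0 < Q.card := Finset.card_pos.2 <| Finset.nonempty_iff_ne_empty.2 fun hc => by
    rw [hc] at hconj; simp at hconj; exact hT0 hconj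
  obtain ⟨t, ht⟩ := h.exists_trace T
  have hn' : ((n - t : ℤ) : R) = ∑ i ∈ S, (u i : R) := by
    push_cast; rw [hsplit, ht]; ring
  set Y := x ^ (m - G (j + 1)) with hYdef
  have hY : 1 ≤ Y := one_le_pow₀ hx.le
  have hxm : x ^ m = x ^ G (j + 1) * Y := by rw [← pow_add]; congr 1; omega
  -- the window sum, scaled to a short sum
  have hshort : ∀ i ∈ P, ∃ b : ℕ, b ≤ G j ∧
      IsSignedPow η (-(b : ℤ)) (((η ^ (-(m : ℤ)) : Rˣ) : R) * u i) := by
    intro i hi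
    simp only [hP, Finset.mem_filter, Finset.mem_univ, true_and] at hi
    refine ⟨m - (e i).natAbs, by omega, ?_⟩
    have := (he i).zpow_mul (-(m : ℤ))
    have h2 : -((m - (e i).natAbs : ℕ) : ℤ) = -(m : ℤ) + e i := by
      have := hmax i; omega
    rwa [h2]
  have hPcard : P.card ≤ k := (Finset.card_le_univ P).trans (by simpa using hr)
  have hTlow : 6 * k * Y ≤ |f T| := by
    have := hgap (Fin r) P (fun i => ((η ^ (-(m : ℤ)) : Rˣ) : R) * u i) hPcard hshort
      (by rw [← Finset.mul_sum]; exact (Units.mul_right_eq_zero _).not.2 hT0)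
    rw [← Finset.mul_sum, ← hT, map_mul, abs_mul, IsSignedPow.map_zpow_unit, ← hxdef,
      abs_of_pos (zpow_pos hx0 _), zpow_neg, zpow_natCast, hxm] at this
    have hG0 : 0 < x ^ G (j + 1) := pow_pos hx0 _
    have h3 : x ^ G (j + 1) * ((x ^ G (j + 1) * Y)⁻¹ * |f T|) = |f T| / Y := by field_simp
    rwa [h3, le_div_iff₀ (by linarith)] at this
  have hTconj : |f (τ T)| ≤ k * Y := by
    rw [← hconj']
    refine (abs_map_sum_le f Q _ Y fun i hi => ?_).trans
      (mul_le_mul_of_nonneg_right (hcard Q) (by linarith))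
    simp only [hQ, Finset.mem_filter, Finset.mem_univ, true_and] at hi
    rw [habs, hYdef, ← zpow_natCast]
    exact zpow_le_zpow_right₀ hx.le (by omega)
  have hrest : |((n - t : ℤ) : ℝ)| ≤ k * Y := by
    rw [abs_intCast_eq f, hn']
    refine (abs_map_sum_le f S _ Y fun i hi => ?_).trans
      (mul_le_mul_of_nonneg_right (hcard S) (by linarith))
    simp only [hS, Finset.mem_filter, Finset.mem_univ, true_and] at hi
    have : (e i).natAbs + G (j + 1) < m := by
      by_contra hc; exact hi (hwin i (by simpa using hc))
    rw [habs, hYdef, ← zpow_natCast]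
    exact zpow_le_zpow_right₀ hx.le (by omega)
  -- `f T` is at least 6kY, while its conjugate and the remaining units contribute at most kY each.
  have hnlow : Y ≤ |(n : ℝ)| := by
    have h1 : (n : ℝ) = f T + f (τ T) + ((n - t : ℤ) : ℝ) := by
      have : f (t : R) = f T + f (τ T) := by rw [ht, map_add]
      rw [map_intCast] at this
      push_cast; rw [← this]; ring
    have h2 : |f T| ≤ |(n : ℝ)| + |f (τ T)| + |((n - t : ℤ) : ℝ)| := by
      have h4 : f T = (n : ℝ) - f (τ T) - ((n - t : ℤ) : ℝ) := by linarith
      rw [h4]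
      exact (abs_sub _ _).trans (by linarith [abs_sub (n : ℝ) (f (τ T))])
    nlinarith
  have hxG : x ^ G (j + 1) ≤ B := by
    have := pow_le_pow_right₀ hx.le hjk
    nlinarith
  have hkB : (k : ℝ) ≤ B := by nlinarith
  have hmB : x ^ m ≤ B * |(n : ℝ)| := by
    rw [hxm]; exact mul_le_mul hxG hnlow (by linarith) (by linarith)
  -- Both P and Q are nonempty, so at least two units are removed even when only one of them is a
  -- singleton.
  have unitCase : ∀ a : ℕ, IsSignedPow η a T → a ≤ m → m ≤ a + G j →
      (∃ (a : ℕ) (z : R) (t n' : ℤ), 2 ≤ k ∧ IsSignedPow η a z ∧ (t : R) = z + τ z ∧ n = t + n' ∧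
        n' ∈ sumsOfUnits R (k - 2) ∧ |(n' : ℝ)| ≤ B * x ^ a ∧ x ^ a ≤ B * |(n : ℝ)|) := by
    intro a haT ham hma
    refine ⟨a, T, t, n - t, by omega, haT, ht, by ring, ?_, ?_, ?_⟩
    · exact mem_sumsOfUnits_of_finset S u (by omega) hn'
    · refine hrest.trans (mul_le_mul hkB ?_ (by linarith) (by linarith))
      exact pow_le_pow_right₀ hx.le (by omega)
    · exact (pow_le_pow_right₀ hx.le ham).trans hmB
  by_cases hP1 : P.card = 1
  · left
    obtain ⟨i, hi⟩ := Finset.card_eq_one.1 hP1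
    have hiP : i ∈ P := by simp [hi]
    simp only [hP, Finset.mem_filter, Finset.mem_univ, true_and] at hiP
    refine unitCase (e i).natAbs ?_ (hmax i) hiP.1
    have h2 : ((e i).natAbs : ℤ) = e i := by omega
    rw [hT, hi, Finset.sum_singleton, h2]
    exact he i
  by_cases hQ1 : Q.card = 1
  · left
    obtain ⟨i, hi⟩ := Finset.card_eq_one.1 hQ1
    have hiQ : i ∈ Q := by simp [hi]
    simp only [hQ, Finset.mem_filter, Finset.mem_univ, true_and] at hiQ
    refine unitCase (e i).natAbs ?_ (hmax i) hiQ.1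
    have h2 : ((e i).natAbs : ℤ) = -e i := by omega
    rw [hconj, hi, Finset.sum_singleton, h2]
    exact h.isSignedPow_conj (he i)
  -- Here P and Q each have at least two elements, so at most k - 4 units remain.
  right
  have hzT : ((η ^ m : Rˣ) : R) * (∑ i ∈ P, ((η ^ (-(m : ℤ)) : Rˣ) : R) * u i) = T := by
    rw [← Finset.mul_sum, ← hT, ← mul_assoc, ← Units.val_mul]
    simp
  refine ⟨m, ∑ i ∈ P, ((η ^ (-(m : ℤ)) : Rˣ) : R) * u i, t, n - t, by omega, ?_, ?_, by ring,
    ?_, ?_, hmB⟩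
  · refine hZ (Fin r) P _ hPcard fun i hi => ?_
    obtain ⟨b, hb, hb'⟩ := hshort i hi
    exact ⟨b, by omega, hb'⟩
  · rw [hzT, ht]
  · exact mem_sumsOfUnits_of_finset S u (by omega) hn'
  · exact hrest.trans (mul_le_mul hkB hnlow (by linarith) (by linarith))

end Decomposition
-- Recursive bounds for the counting function, and its values for k = 0, 1
section Counting

variable {R : Type*} [CommRing R] {f : R →+* ℝ} {τ : R →+* R} {η : Rˣ}

open Classical in
/-- The integers of absolute value at most `X` that are sums of at most `k` units of `R`. -/
noncomputable def sumsUpTo (R : Type*) [CommRing R] (k : ℕ) (X : ℝ) : Finset ℤ :=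
  (Finset.Icc (-⌊X⌋) ⌊X⌋).filter (· ∈ sumsOfUnits R k)

theorem mem_sumsUpTo {k : ℕ} {X : ℝ} {n : ℤ} :
    n ∈ sumsUpTo R k X ↔ n ∈ sumsOfUnits R k ∧ |(n : ℝ)| ≤ X := by
  have h : -⌊X⌋ ≤ n ↔ -X ≤ n := by
    rw [neg_le, Int.le_floor]; push_cast; exact neg_le
  simp [sumsUpTo, h, Int.le_floor, abs_le, and_comm]

theorem IsRealConj.cast_injective (_h : IsRealConj f τ η) {m n : ℤ} (hmn : (m : R) = n) : m = n := by
  have := congrArg f hmn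
  simpa using this

/-- The conjugate of η^a has absolute value x^(-a) ≤ 1, so the trace is within 1 of x^a. -/
theorem IsRealConj.exists_traces (h : IsRealConj f τ η) :
    ∃ T : ℕ → ℤ, (∀ a, (T a : R) = ((η ^ a : Rˣ) : R) + τ ((η ^ a : Rˣ) : R)) ∧
      (∀ a, |(T a : ℝ) - f η ^ a| ≤ 1) ∧ ∀ a, ∀ ε : ℤ, ε = 1 ∨ ε = -1 →
        ε * T a ∈ sumsOfUnits R 2 := by
  choose T hT using fun a : ℕ => h.exists_trace ((η ^ a : Rˣ) : R)
  have hsp : ∀ a : ℕ, IsSignedPow η a ((η ^ a : Rˣ) : R) := fun a => Or.inl (by simp)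
  refine ⟨T, hT, fun a => ?_, fun a ε hε => ?_⟩
  · have h1 := congrArg f (hT a)
    rw [map_intCast, map_add] at h1
    have h2 : f ((η ^ a : Rˣ) : R) = f η ^ a := by simp
    rw [h1, h2, add_sub_cancel_left, (h.isSignedPow_conj (hsp a)).abs_map h.pos]
    exact zpow_le_one_of_nonpos₀ h.one_lt.le (by omega)
  · obtain ⟨v, hv⟩ := IsRealConj.exists_unit_of_isSignedPow (h.isSignedPow_conj (hsp a))
    rcases hε with rfl | rfl
    · exact ⟨2, le_rfl, ![η ^ a, v], by rw [Fin.sum_univ_two]; simp [hT, hv]⟩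
    · exact ⟨2, le_rfl, ![-η ^ a, -v], by rw [Fin.sum_univ_two]; simp [hT, hv]; ring⟩

/-- Recursive upper bound for the number of sums of `k + 2` units. -/
theorem IsRealConj.exists_card_le (h : IsRealConj f τ η) (k : ℕ) :
    ∃ (A B : ℝ) (W : ℕ), 0 ≤ A ∧ 2 ≤ B ∧ ∀ X : ℝ, ∀ K : ℕ, 0 ≤ X →
      (∀ a : ℕ, f η ^ a ≤ B * X → a < K) →
      ((sumsUpTo R (k + 2) X).card : ℝ) ≤ A +
        ∑ a ∈ Finset.range K, 2 * ((sumsUpTo R k (B * f η ^ a)).card : ℝ) +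
        (if 2 ≤ k then (W : ℝ) * K * ((sumsUpTo R (k - 2) (B * X)).card : ℝ) else 0) := by
  classical
  obtain ⟨B, Z, hB, hdec⟩ := h.exists_decomposition (k + 2)
  obtain ⟨T, hT, -, -⟩ := h.exists_traces
  choose tr htr using h.exists_trace
  refine ⟨(Finset.Icc (-⌊B⌋) ⌊B⌋).card, B, Z.card, by positivity, hB, fun X K hX hK => ?_⟩
  -- The remainder's range depends on a, not on X; this produces the factor 1/(ρ + 1) on summation.
  -- In `V` the cruder range `B * X` suffices.
  let U : Finset ℤ := (Finset.range K).biUnion fun a => ({1, -1} : Finset ℤ).biUnion fun ε =>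
    (sumsUpTo R k (B * f η ^ a)).image (ε * T a + ·)
  let V : Finset ℤ := if 2 ≤ k then (Finset.range K).biUnion fun m => Z.biUnion fun z =>
    (sumsUpTo R (k - 2) (B * X)).image (tr (((η ^ m : Rˣ) : R) * z) + ·) else ∅
  have hsub : sumsUpTo R (k + 2) X ⊆ Finset.Icc (-⌊B⌋) ⌊B⌋ ∪ U ∪ V := by
    intro n hn
    obtain ⟨hn1, hn2⟩ := mem_sumsUpTo.1 hn
    have hBX : B * |(n : ℝ)| ≤ B * X := by gcongr
    rcases hdec n hn1 with h1 | ⟨a, z, t, n', -, hz, ht, rfl, hn', hb1, hb2⟩ |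
      ⟨m, z, t, n', hk, hz, ht, rfl, hn', hb1, hb2⟩
    · refine Finset.mem_union_left _ (Finset.mem_union_left _ (Finset.mem_Icc.2 ?_))
      have := abs_le.1 h1
      exact ⟨by rw [neg_le, Int.le_floor]; push_cast; linarith, Int.le_floor.2 this.2⟩
    · refine Finset.mem_union_left _ (Finset.mem_union_right _ ?_)
      obtain ⟨ε, hε, hεt⟩ : ∃ ε : ℤ, ε ∈ ({1, -1} : Finset ℤ) ∧ ε * T a = t := by
        rcases hz with hz | hz
        · exact ⟨1, by simp, h.cast_injective (by simp [hT, ht, hz])⟩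
        · exact ⟨-1, by simp, h.cast_injective (by simp [hT, ht, hz]; ring)⟩
      refine Finset.mem_biUnion.2 ⟨a, Finset.mem_range.2 (hK a (hb2.trans hBX)),
        Finset.mem_biUnion.2 ⟨ε, hε, Finset.mem_image.2 ⟨n', ?_, by rw [hεt]⟩⟩⟩
      exact mem_sumsUpTo.2 ⟨by simpa using hn', hb1⟩
    · refine Finset.mem_union_right _ ?_
      simp only [V, if_pos (show 2 ≤ k by omega)]
      refine Finset.mem_biUnion.2 ⟨m, Finset.mem_range.2 (hK m (hb2.trans hBX)),
        Finset.mem_biUnion.2 ⟨z, hz, Finset.mem_image.2 ⟨n', ?_, ?_⟩⟩⟩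
      · exact mem_sumsUpTo.2 ⟨by simpa using hn', hb1.trans hBX⟩
      · rw [h.cast_injective ((htr _).trans ht.symm)]
  have hU : U.card ≤ ∑ a ∈ Finset.range K, 2 * (sumsUpTo R k (B * f η ^ a)).card := by
    refine Finset.card_biUnion_le.trans (Finset.sum_le_sum fun a _ => ?_)
    exact Finset.card_biUnion_le_card_mul _ _ _ fun ε _ => Finset.card_image_le
  have hV : V.card ≤ if 2 ≤ k then Z.card * K * (sumsUpTo R (k - 2) (B * X)).card else 0 := by
    simp only [V]
    split_ifs
    · refine (Finset.card_biUnion_le_card_mul _ _ _ fun m _ =>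
        Finset.card_biUnion_le_card_mul _ _ _ fun z _ => Finset.card_image_le).trans (le_of_eq ?_)
      rw [Finset.card_range]; ring
    · simp
  have := (Finset.card_le_card hsub).trans ((Finset.card_union_le _ _).trans
    (add_le_add ((Finset.card_union_le _ _).trans (add_le_add le_rfl hU)) hV))
  exact_mod_cast this

/-- Recursive lower bound for the number of sums of `k + 2` units. -/
theorem IsRealConj.exists_le_card (h : IsRealConj f τ η) :
    ∃ D : ℝ, 1 ≤ D ∧ ∀ (k : ℕ) (X : ℝ) (a₀ K : ℕ), D ≤ f η ^ a₀ →
      (∀ a : ℕ, a₀ ≤ a → a < K → 3 * f η ^ a ≤ X) →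
      ∑ a ∈ Finset.Ico a₀ K, 2 * ((sumsUpTo R k (f η ^ a / D)).card : ℝ) ≤
        ((sumsUpTo R (k + 2) X).card : ℝ) := by
  classical
  obtain ⟨T, hT, hTx, hTs⟩ := h.exists_traces
  have hx := h.one_lt
  have hx0 := h.pos
  set x := f η with hxdef
  have hx1 : 0 < x - 1 := by linarith
  -- With D = 4(x+1)/(x-1), the intervals of radius 2x^a/D about ±x^a are disjoint: D(x-1) > 2(x+1)
  -- separates different a, and D > 2 separates the two signs.
  have hD4 : 4 ≤ 4 * (x + 1) / (x - 1) := by rw [le_div_iff₀ hx1]; linarith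
  have hDx : 4 * (x + 1) / (x - 1) * (x - 1) = 4 * (x + 1) := div_mul_cancel₀ _ hx1.ne'
  refine ⟨4 * (x + 1) / (x - 1), by linarith, fun k X a₀ K ha₀ hK => ?_⟩
  generalize 4 * (x + 1) / (x - 1) = D at hD4 hDx ha₀
  have hD0 : 0 < D := by linarith
  let I : Finset (ℕ × ℤ) := Finset.Ico a₀ K ×ˢ ({1, -1} : Finset ℤ)
  let F : ℕ × ℤ → Finset ℤ := fun p =>
    (sumsUpTo R k (x ^ p.1 / D)).image (p.2 * T p.1 + ·)
  have hsign : ∀ p ∈ I, p.2 = 1 ∨ p.2 = -1 := fun p hp => by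
    have := (Finset.mem_product.1 hp).2; simpa using this
  have hnear : ∀ p ∈ I, ∀ n ∈ F p, D * |(n : ℝ) - p.2 * x ^ p.1| ≤ 2 * x ^ p.1 := by
    intro p hp n hn
    obtain ⟨n', hn', rfl⟩ := Finset.mem_image.1 hn
    have h1 := (mem_sumsUpTo.1 hn').2
    have ha : D ≤ x ^ p.1 := ha₀.trans (pow_le_pow_right₀ hx.le
      (Finset.mem_Ico.1 (Finset.mem_product.1 hp).1).1)
    have h2 : |(p.2 : ℝ) * (T p.1 - x ^ p.1)| ≤ 1 := by
      rw [abs_mul]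
      have := hTx p.1
      rcases hsign p hp with h3 | h3 <;> simpa [h3] using this
    have h3 : |((p.2 * T p.1 + n' : ℤ) : ℝ) - p.2 * x ^ p.1| ≤ 1 + x ^ p.1 / D := by
      have : ((p.2 * T p.1 + n' : ℤ) : ℝ) - p.2 * x ^ p.1 = p.2 * (T p.1 - x ^ p.1) + n' := by
        push_cast; ring
      rw [this]
      exact (abs_add_le _ _).trans (add_le_add h2 h1)
    calc _ ≤ D * (1 + x ^ p.1 / D) := by gcongr
      _ = D + x ^ p.1 := by field_simp
      _ ≤ _ := by linarith
  have habs : ∀ p ∈ I, |(p.2 : ℝ) * x ^ p.1| = x ^ p.1 := fun p hp => by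
    have : |x| = x := abs_of_pos hx0
    rcases hsign p hp with h3 | h3 <;> simp [h3, this]
  have hlt : ∀ p ∈ I, ∀ q ∈ I, ∀ n, n ∈ F p → n ∈ F q → ¬ p.1 < q.1 := by
    intro p hp q hq n hnp hnq hpq
    have h1 := hnear p hp n hnp
    have h2 := hnear q hq n hnq
    have h3 := habs p hp
    have h4 := habs q hq
    have h5 : |(n : ℝ)| ≤ |(n : ℝ) - p.2 * x ^ p.1| + x ^ p.1 := by
      have := abs_add_le ((n : ℝ) - p.2 * x ^ p.1) (p.2 * x ^ p.1)
      rwa [h3, sub_add_cancel] at this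
    have h6 : x ^ q.1 ≤ |(n : ℝ)| + |(n : ℝ) - q.2 * x ^ q.1| := by
      have := abs_sub (n : ℝ) ((n : ℝ) - q.2 * x ^ q.1)
      rwa [sub_sub_cancel, h4] at this
    have h7 : x * x ^ p.1 ≤ x ^ q.1 := by
      rw [← pow_succ']; exact pow_le_pow_right₀ hx.le hpq
    have hp0 : 0 < x ^ p.1 := pow_pos hx0 _
    have h8 : (D - 2) * x ^ q.1 ≤ (D + 2) * x ^ p.1 := by nlinarith
    have h9 : (D - 2) * (x * x ^ p.1) ≤ (D - 2) * x ^ q.1 :=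
      mul_le_mul_of_nonneg_left h7 (by linarith)
    have h10 : (D * (x - 1) - 2 * (x + 1)) * x ^ p.1 ≤ 0 := by linarith
    rw [hDx] at h10
    have : 0 < (4 * (x + 1) - 2 * (x + 1)) * x ^ p.1 := mul_pos (by linarith) hp0
    linarith
  have hdisj : (I : Set (ℕ × ℤ)).PairwiseDisjoint F := by
    intro p hp q hq hpq
    refine Finset.disjoint_left.2 fun n hnp hnq => hpq ?_
    have h1 : p.1 = q.1 := le_antisymm (not_lt.1 (hlt q hq p hp n hnq hnp))
      (not_lt.1 (hlt p hp q hq n hnp hnq))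
    refine Prod.ext h1 ?_
    have h2 := hnear p hp n hnp
    have h3 := hnear q hq n hnq
    rw [← h1] at h3
    have hp0 : 0 < x ^ p.1 := pow_pos hx0 _
    by_contra hne
    have h4 : |(p.2 : ℝ) * x ^ p.1 - q.2 * x ^ p.1| = 2 * x ^ p.1 := by
      have habsx : |x| = x := abs_of_pos hx0
      rcases hsign p hp with h5 | h5 <;> rcases hsign q hq with h6 | h6
      · exact absurd (h5.trans h6.symm) hne
      · rw [h5, h6, ← abs_of_pos (show 0 < 2 * x ^ p.1 by positivity)]
        congr 1; push_cast; ring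
      · rw [h5, h6, ← abs_of_pos (show 0 < 2 * x ^ p.1 by positivity), ← abs_neg]
        congr 1; push_cast; ring
      · exact absurd (h5.trans h6.symm) hne
    have h5 := abs_sub ((n : ℝ) - q.2 * x ^ p.1) ((n : ℝ) - p.2 * x ^ p.1)
    rw [sub_sub_sub_cancel_left, h4] at h5
    nlinarith
  have hsub : I.biUnion F ⊆ sumsUpTo R (k + 2) X := by
    intro n hn
    obtain ⟨p, hp, hnp⟩ := Finset.mem_biUnion.1 hn
    have h1 := hnear p hp n hnp
    have h3 := habs p hp
    obtain ⟨ha1, ha2⟩ := Finset.mem_Ico.1 (Finset.mem_product.1 hp).1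
    refine mem_sumsUpTo.2 ⟨?_, (?_ : _ ≤ 3 * x ^ p.1).trans (hK p.1 ha1 ha2)⟩
    · obtain ⟨n', hn', rfl⟩ := Finset.mem_image.1 hnp
      rw [add_comm k]
      exact add_mem_sumsOfUnits (hTs _ _ (hsign p hp)) (mem_sumsUpTo.1 hn').1
    · have h5 : |(n : ℝ)| ≤ |(n : ℝ) - p.2 * x ^ p.1| + x ^ p.1 := by
        have := abs_add_le ((n : ℝ) - p.2 * x ^ p.1) (p.2 * x ^ p.1)
        rwa [h3, sub_add_cancel] at this
      have := mul_le_mul_of_nonneg_right hD4 (abs_nonneg ((n : ℝ) - p.2 * x ^ p.1))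
      have hp0 : 0 < x ^ p.1 := pow_pos hx0 _
      linarith
  have hcard := Finset.card_le_card hsub
  rw [Finset.card_biUnion hdisj, Finset.sum_product] at hcard
  have hF : ∀ a ε, (F (a, ε)).card = (sumsUpTo R k (x ^ a / D)).card := fun a ε =>
    Finset.card_image_of_injective _ (add_right_injective _)
  simp only [hF, Finset.sum_const, smul_eq_mul] at hcard
  exact_mod_cast hcard

theorem sumsOfUnits_zero (h : IsRealConj f τ η) : sumsOfUnits R 0 = {0} := by
  ext n
  constructor
  · rintro ⟨r, hr, u, hu⟩
    obtain rfl := Nat.le_zero.1 hr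
    exact h.cast_injective (by simpa using hu)
  · rintro rfl
    exact ⟨0, le_rfl, Fin.elim0, by simp⟩

/-- A rational unit ±η^a equals its conjugate, so x^a = x^(-a) and a = 0. -/
theorem sumsOfUnits_one (h : IsRealConj f τ η) : sumsOfUnits R 1 = {0, 1, -1} := by
  ext n
  constructor
  · rintro ⟨r, hr, u, hu⟩
    rcases Nat.le_one_iff_eq_zero_or_eq_one.1 hr with rfl | rfl
    · left; exact h.cast_injective (by simpa using hu)
    · right
      rw [Fin.sum_univ_one] at hu
      obtain ⟨a, ha⟩ := h.exists_zpow (u 0)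
      have hs := IsSignedPow.mk_unit ha
      have h1 := hs.abs_map h.pos
      have h2 := (h.isSignedPow_conj hs).abs_map h.pos
      rw [← hu, map_intCast] at h1
      rw [← hu, map_intCast, map_intCast, h1] at h2
      have ha0 : a = -a := zpow_right_injective₀ h.pos h.one_lt.ne' h2
      obtain rfl : a = 0 := by omega
      have h3 : |n| = 1 := by exact_mod_cast (by simpa using h1 : |(n : ℝ)| = 1)
      exact (abs_eq zero_le_one).1 h3
  · rintro (rfl | rfl | rfl)
    · exact ⟨0, zero_le_one, Fin.elim0, by simp⟩
    · exact ⟨1, le_rfl, fun _ => 1, by simp⟩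
    · exact ⟨1, le_rfl, fun _ => -1, by simp⟩

theorem card_sumsUpTo_zero (h : IsRealConj f τ η) {X : ℝ} (hX : 2 ≤ X) :
    (sumsUpTo R 0 X).card = 1 := by
  have : sumsUpTo R 0 X = {0} := by
    ext n
    rw [mem_sumsUpTo, sumsOfUnits_zero h]
    constructor
    · exact fun hn => Finset.mem_singleton.2 hn.1
    · intro hn
      obtain rfl := Finset.mem_singleton.1 hn
      exact ⟨rfl, by simp; linarith⟩
  rw [this]; rfl

theorem card_sumsUpTo_one (h : IsRealConj f τ η) {X : ℝ} (hX : 2 ≤ X) :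
    (sumsUpTo R 1 X).card = 3 := by
  have : sumsUpTo R 1 X = {0, 1, -1} := by
    ext n
    rw [mem_sumsUpTo, sumsOfUnits_one h]
    constructor
    · exact fun hn => by simpa using hn.1
    · intro hn
      refine ⟨by simpa using hn, ?_⟩
      have hn : n = 0 ∨ n = 1 ∨ n = -1 := by simpa using hn
      rcases hn with rfl | rfl | rfl <;> simp <;> linarith
  rw [this]; rfl

end Counting
-- Comparing sums of powers with the integrated power
section PowerSums

theorem mul_pow_pred_mul_sub_le {a b : ℝ} (hb : 0 ≤ b) (hab : b ≤ a) (p : ℕ) :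
    p * b ^ (p - 1) * (a - b) ≤ a ^ p - b ^ p := by
  induction p with
  | zero => simp
  | succ p ih =>
    have h1 : (p : ℝ) * b ^ (p - 1) * b = p * b ^ p := by
      rcases p with _ | p
      · simp
      · simp [pow_succ]; ring
    have h2 := mul_le_mul_of_nonneg_left ih hb
    have h3 : b ^ p ≤ a ^ p := pow_le_pow_left₀ hb hab p
    have h4 := mul_le_mul_of_nonneg_right h3 (sub_nonneg.2 hab)
    have h5 : b * (p * b ^ (p - 1) * (a - b)) = p * b ^ p * (a - b) := by rw [← h1]; ring
    rw [h5] at h2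
    simp only [Nat.add_sub_cancel, Nat.cast_add, Nat.cast_one, pow_succ]
    linarith

theorem pow_sub_pow_le_mul {a b : ℝ} (hb : 0 ≤ b) (hab : b ≤ a) (p : ℕ) :
    a ^ p - b ^ p ≤ p * a ^ (p - 1) * (a - b) := by
  induction p with
  | zero => simp
  | succ p ih =>
    have ha := hb.trans hab
    have h1 : (p : ℝ) * a ^ (p - 1) * a = p * a ^ p := by
      rcases p with _ | p
      · simp
      · simp [pow_succ]; ring
    have h2 := mul_le_mul_of_nonneg_left ih ha
    have h3 : b ^ p ≤ a ^ p := pow_le_pow_left₀ hb hab p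
    have h4 := mul_le_mul_of_nonneg_right h3 (sub_nonneg.2 hab)
    have h5 : a * (p * a ^ (p - 1) * (a - b)) = p * a ^ p * (a - b) := by rw [← h1]; ring
    rw [h5] at h2
    simp only [Nat.add_sub_cancel, Nat.cast_add, Nat.cast_one, pow_succ]
    linarith

/-- Each summand is at most the increment of t^p over the next unit step, and the increments
telescope. The lower bound below compares with the preceding step instead. -/
theorem sum_mul_pow_pred_le {β : ℝ} (hβ : 0 ≤ β) (p K : ℕ) :
    ∑ a ∈ Finset.range K, (p : ℝ) * (a + β) ^ (p - 1) ≤ (K + β) ^ p := by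
  induction K with
  | zero => simp; positivity
  | succ K ih =>
    rw [Finset.sum_range_succ]
    have h := mul_pow_pred_mul_sub_le (a := K + 1 + β) (b := K + β) (by positivity) (by linarith) p
    have h1 : (K + 1 + β : ℝ) - (K + β) = 1 := by ring
    rw [h1, mul_one] at h
    push_cast
    linarith

theorem le_sum_mul_pow_pred {γ : ℝ} (hγ : 1 ≤ γ) (p K : ℕ) :
    (K + γ - 1) ^ p - (γ - 1) ^ p ≤ ∑ a ∈ Finset.range K, (p : ℝ) * (a + γ) ^ (p - 1) := by
  induction K with
  | zero => simp
  | succ K ih =>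
    rw [Finset.sum_range_succ]
    have hK : (0 : ℝ) ≤ K := by positivity
    have h := pow_sub_pow_le_mul (a := K + γ) (b := K + γ - 1) (by linarith) (by linarith) p
    have h1 : (K + γ : ℝ) - (K + γ - 1) = 1 := by ring
    rw [h1, mul_one] at h
    have h2 : ((K + 1 : ℕ) : ℝ) + γ - 1 = K + γ := by push_cast; ring
    rw [h2]
    linarith

/-- Since l stays away from 0, a bounded shift of l costs only a constant factor. -/
theorem add_pow_le_mul_pow {L₀ δ l : ℝ} (hL : 0 < L₀) (hδ : 0 ≤ δ) (hl : L₀ ≤ l) (p : ℕ) :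
    (l + δ) ^ p ≤ (1 + δ / L₀) ^ p * l ^ p := by
  rw [← mul_pow]
  refine pow_le_pow_left₀ (by linarith) ?_ p
  have : δ / L₀ * L₀ ≤ δ / L₀ * l := mul_le_mul_of_nonneg_left hl (by positivity)
  rw [div_mul_cancel₀ _ hL.ne'] at this
  linarith

/-- The inductive step for the upper bound, with l = log X / log η: `A` counts the small integers,
the sum the traces of units, and the `D` term the other traces. -/
theorem exists_upper_step (p : ℕ) {c C A D L₀ β : ℝ} (hc : 0 ≤ c) (hC : 0 ≤ C) (hA : 0 ≤ A)
    (hD : 0 ≤ D) (hL : 0 < L₀) (hβ : 0 ≤ β) :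
    ∃ C' : ℝ, 0 ≤ C' ∧ ∀ l : ℝ, L₀ ≤ l → ∀ K : ℕ, (K : ℝ) ≤ l + β + 1 →
      A + ∑ a ∈ Finset.range K, 2 * (c * (2 * (a + β)) ^ p + C * (p * (a + β) ^ (p - 1))) +
        D * (l + (2 * β + 1)) ^ p ≤ c / (p + 1) * (2 * l) ^ (p + 1) + C' * l ^ p := by
  set δ := 2 * β + 1 with hδdef
  have hδ : 0 ≤ δ := by positivity
  set M := (1 + δ / L₀) ^ p with hM
  have hM0 : 0 ≤ M := by positivity
  refine ⟨A / L₀ ^ p + 2 ^ (p + 1) * c * (M * δ) + 2 * C * M + D * M, by positivity,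
    fun l hl K hK => ?_⟩
  have hl0 : 0 < l := hL.trans_le hl
  have hM1 := add_pow_le_mul_pow hL hδ hl p
  rw [← hM] at hM1
  have hKδ : (K : ℝ) + β ≤ l + δ := by linarith
  have hA1 : A ≤ A / L₀ ^ p * l ^ p := by
    rw [div_mul_eq_mul_div, le_div_iff₀ (by positivity)]
    exact mul_le_mul_of_nonneg_left (pow_le_pow_left₀ hL.le hl p) hA
  have h1 := sum_mul_pow_pred_le hβ (p + 1) K
  have h2 := sum_mul_pow_pred_le hβ p K
  have h3 : (K + β : ℝ) ^ (p + 1) ≤ (l + δ) ^ (p + 1) := pow_le_pow_left₀ (by positivity) hKδ _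
  have h4 : (K + β : ℝ) ^ p ≤ (l + δ) ^ p := pow_le_pow_left₀ (by positivity) hKδ _
  have h5 := pow_sub_pow_le_mul hl0.le (show l ≤ l + δ by linarith) (p + 1)
  simp only [Nat.add_sub_cancel, add_sub_cancel_left, Nat.cast_add, Nat.cast_one] at h1 h5
  rw [← Finset.mul_sum] at h1
  have hsum : ∑ a ∈ Finset.range K, 2 * (c * (2 * (a + β)) ^ p + C * (p * (a + β) ^ (p - 1))) =
      2 ^ (p + 1) * c * ∑ a ∈ Finset.range K, ((a : ℝ) + β) ^ p +
      2 * C * ∑ a ∈ Finset.range K, (p : ℝ) * (a + β) ^ (p - 1) := by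
    rw [Finset.mul_sum, Finset.mul_sum, ← Finset.sum_add_distrib]
    refine Finset.sum_congr rfl fun a _ => ?_
    rw [mul_pow]; ring
  have hp : (0 : ℝ) < p + 1 := by positivity
  have h6 : ∑ a ∈ Finset.range K, ((a : ℝ) + β) ^ p ≤ l ^ (p + 1) / (p + 1) + M * δ * l ^ p := by
    have : ((p : ℝ) + 1) * ∑ a ∈ Finset.range K, ((a : ℝ) + β) ^ p ≤
        (p + 1) * (l ^ (p + 1) / (p + 1) + M * δ * l ^ p) := by
      have h7 : ((p : ℝ) + 1) * (l ^ (p + 1) / (p + 1) + M * δ * l ^ p) =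
          l ^ (p + 1) + (p + 1) * (M * l ^ p) * δ := by field_simp
      rw [h7]
      have : (p + 1 : ℝ) * (l + δ) ^ p * δ ≤ (p + 1) * (M * l ^ p) * δ := by gcongr
      linarith
    exact le_of_mul_le_mul_left this hp
  have h8 := mul_le_mul_of_nonneg_left h6 (show 0 ≤ 2 ^ (p + 1) * c by positivity)
  have h9 := mul_le_mul_of_nonneg_left (h2.trans (h4.trans hM1)) (show 0 ≤ 2 * C by positivity)
  have h10 := mul_le_mul_of_nonneg_left hM1 hD
  have h11 : c / (p + 1) * (2 * l) ^ (p + 1) = 2 ^ (p + 1) * c * (l ^ (p + 1) / (p + 1)) := by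
    rw [mul_pow]; ring
  rw [hsum, h11]
  linarith

theorem exists_lower_step (p : ℕ) {c C L₀ e γ : ℝ} (hc : 0 ≤ c) (hC : 0 ≤ C) (hL : 0 < L₀)
    (he : 0 ≤ e) (hγ : 1 ≤ γ) :
    ∃ C' : ℝ, 0 ≤ C' ∧ ∀ l : ℝ, L₀ ≤ l → ∀ K : ℕ, (K : ℝ) ≤ l + 1 → l - e ≤ K →
      c / (p + 1) * (2 * l) ^ (p + 1) - C' * l ^ p ≤
        ∑ a ∈ Finset.range K, 2 * (c * (2 * (a + γ)) ^ p - C * (p * (a + γ) ^ (p - 1))) := by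
  set δ := γ + 1 with hδdef
  have hδ : 0 ≤ δ := by positivity
  set M := (1 + δ / L₀) ^ p with hM
  have hM0 : 0 ≤ M := by positivity
  have hγ1 : 0 ≤ γ - 1 := by linarith
  refine ⟨2 ^ (p + 1) * c * (e + (γ - 1) ^ (p + 1) / L₀ ^ p) + 2 * C * M, by positivity,
    fun l hl K hK1 hK2 => ?_⟩
  have hl0 : 0 < l := hL.trans_le hl
  have hM1 := add_pow_le_mul_pow hL hδ hl p
  rw [← hM] at hM1
  have hK0 : (0 : ℝ) ≤ K := by positivity
  have h1 := le_sum_mul_pow_pred hγ (p + 1) K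
  have h2 := sum_mul_pow_pred_le (zero_le_one.trans hγ) p K
  have h4 : (K + γ : ℝ) ^ p ≤ (l + δ) ^ p := pow_le_pow_left₀ (by positivity) (by linarith) _
  simp only [Nat.add_sub_cancel, Nat.cast_add, Nat.cast_one] at h1
  rw [← Finset.mul_sum] at h1
  have hsum : ∑ a ∈ Finset.range K, 2 * (c * (2 * (a + γ)) ^ p - C * (p * (a + γ) ^ (p - 1))) =
      2 ^ (p + 1) * c * ∑ a ∈ Finset.range K, ((a : ℝ) + γ) ^ p -
      2 * C * ∑ a ∈ Finset.range K, (p : ℝ) * (a + γ) ^ (p - 1) := by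
    rw [Finset.mul_sum, Finset.mul_sum, ← Finset.sum_sub_distrib]
    refine Finset.sum_congr rfl fun a _ => ?_
    rw [mul_pow]; ring
  have hp : (0 : ℝ) < p + 1 := by positivity
  have h5 : l ^ (p + 1) - (K + γ - 1) ^ (p + 1) ≤ (p + 1) * l ^ p * e := by
    -- The truncated endpoint may lie on either side of l; only the second case loses anything.
    rcases le_total l (K + γ - 1) with hle | hle
    · have := pow_le_pow_left₀ hl0.le hle (p + 1)
      have h0 : 0 ≤ (p + 1) * l ^ p * e := by positivity
      linarith
    · have := pow_sub_pow_le_mul (show (0 : ℝ) ≤ K + γ - 1 by linarith) hle (p + 1)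
      simp only [Nat.add_sub_cancel, Nat.cast_add, Nat.cast_one] at this
      exact this.trans (mul_le_mul_of_nonneg_left (by linarith) (by positivity))
  have hγ2 : (γ - 1) ^ (p + 1) ≤ (p + 1) * ((γ - 1) ^ (p + 1) / L₀ ^ p * l ^ p) := by
    have h6 : (γ - 1) ^ (p + 1) ≤ (γ - 1) ^ (p + 1) / L₀ ^ p * l ^ p := by
      rw [div_mul_eq_mul_div, le_div_iff₀ (by positivity)]
      exact mul_le_mul_of_nonneg_left (pow_le_pow_left₀ hL.le hl p) (by positivity)
    have h7 : 0 ≤ (γ - 1) ^ (p + 1) / L₀ ^ p * l ^ p := by positivity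
    have hp' : (0 : ℝ) ≤ p := by positivity
    nlinarith
  have h6 : l ^ (p + 1) / (p + 1) - (e + (γ - 1) ^ (p + 1) / L₀ ^ p) * l ^ p ≤
      ∑ a ∈ Finset.range K, ((a : ℝ) + γ) ^ p := by
    refine le_of_mul_le_mul_left ?_ hp
    have h7 : ((p : ℝ) + 1) * (l ^ (p + 1) / (p + 1) - (e + (γ - 1) ^ (p + 1) / L₀ ^ p) * l ^ p) =
        l ^ (p + 1) - (p + 1) * l ^ p * e - (p + 1) * ((γ - 1) ^ (p + 1) / L₀ ^ p * l ^ p) := by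
      rw [mul_sub, mul_div_cancel₀ _ hp.ne']; ring
    rw [h7]
    linarith
  have h8 := mul_le_mul_of_nonneg_left h6 (show 0 ≤ 2 ^ (p + 1) * c by positivity)
  have h9 := mul_le_mul_of_nonneg_left (h2.trans (h4.trans hM1)) (show 0 ≤ 2 * C by positivity)
  have h11 : c / (p + 1) * (2 * l) ^ (p + 1) = 2 ^ (p + 1) * c * (l ^ (p + 1) / (p + 1)) := by
    rw [mul_pow]; ring
  rw [hsum, h11]
  linarith

end PowerSums
-- Induction on k and the asymptotic formula
section Asymptotics

theorem leadingConst_nonneg (k : ℕ) : 0 ≤ leadingConst k := by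
  unfold leadingConst; split_ifs <;> positivity

theorem leadingConst_add_two (k : ℕ) :
    leadingConst (k + 2) = leadingConst k / ((k / 2 : ℕ) + 1) := by
  have h1 : (k + 2) / 2 = k / 2 + 1 := by omega
  have h2 : Even (k + 2) ↔ Even k := by simp [Nat.even_add]
  simp only [leadingConst, h1, h2, Nat.factorial_succ, Nat.cast_mul, Nat.cast_add, Nat.cast_one]
  split_ifs <;> rw [div_div, mul_comm]

variable {R : Type*} [CommRing R] {f : R →+* ℝ} {τ : R →+* R} {η : Rˣ}

theorem log_mul_pow_div {x B : ℝ} (hx : 1 < x) (hB : 0 < B) (a : ℕ) :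
    Real.log (B * x ^ a) / Real.log x = a + Real.log B / Real.log x := by
  have h0 : Real.log x ≠ 0 := (Real.log_pos hx).ne'
  have hx0 : 0 < x := by linarith
  rw [Real.log_mul hB.ne' (pow_pos hx0 _).ne', Real.log_pow]
  field_simp
  ring

/-- The factor `k / 2` in the error makes it vanish for k = 0, 1, where the count is exact and `k /
2 - 1` truncates to 0; it is also the form that telescopes in `exists_upper_step`. -/
theorem IsRealConj.exists_card_le_main (h : IsRealConj f τ η) (k : ℕ) :
    ∃ C : ℝ, 0 ≤ C ∧ ∀ X : ℝ, 2 ≤ X → ((sumsUpTo R k X).card : ℝ) ≤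
      leadingConst k * (2 * (Real.log X / Real.log (f η))) ^ (k / 2) +
        C * ((k / 2 : ℕ) * (Real.log X / Real.log (f η)) ^ (k / 2 - 1)) := by
  have hx := h.one_lt
  have hx0 := h.pos
  have hlx : 0 < Real.log (f η) := Real.log_pos hx
  induction k using Nat.strong_induction_on with
  | _ k ih =>
  rcases k with _ | _ | k
  · exact ⟨0, le_rfl, fun X hX => by simp [card_sumsUpTo_zero h hX, leadingConst]⟩
  · exact ⟨0, le_rfl, fun X hX => by simp [card_sumsUpTo_one h hX, leadingConst]⟩
  obtain ⟨A, B, W, hA, hB, hrec⟩ := h.exists_card_le k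
  obtain ⟨C, hC, hmain⟩ := ih k (by omega)
  have hlB : 0 < Real.log B := Real.log_pos (by linarith)
  have hL₀ : 0 < Real.log 2 / Real.log (f η) := div_pos (Real.log_pos one_lt_two) hlx
  set x := f η with hxdef
  set β := Real.log B / Real.log x with hβdef
  set L₀ := Real.log 2 / Real.log x with hL₀def
  have hβ : 0 < β := div_pos hlB hlx
  have hlX : ∀ X : ℝ, 2 ≤ X → L₀ ≤ Real.log X / Real.log x := fun X hX =>
    div_le_div_of_nonneg_right (Real.log_le_log two_pos hX) hlx.le
  have hlBX : ∀ X : ℝ, 2 ≤ X → Real.log (B * X) / Real.log x = Real.log X / Real.log x + β :=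
    fun X hX => by rw [Real.log_mul (by linarith) (by linarith), add_div, add_comm]
  -- The count at k - 2 has order l^(k/2 - 1), and the O(l) choices of exponent raise it to l^(k/2),
  -- the permitted error for k + 2.
  obtain ⟨D, hD, hlow⟩ : ∃ D : ℝ, 0 ≤ D ∧ ∀ X : ℝ, 2 ≤ X → ∀ K : ℕ,
      (K : ℝ) ≤ Real.log X / Real.log x + β + 1 →
      (if 2 ≤ k then (W : ℝ) * K * ((sumsUpTo R (k - 2) (B * X)).card : ℝ) else 0) ≤
        D * (Real.log X / Real.log x + (2 * β + 1)) ^ (k / 2) := by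
    by_cases hk : 2 ≤ k
    · obtain ⟨C₂, hC₂, hm₂⟩ := ih (k - 2) (by omega)
      set q := (k - 2) / 2 with hq
      have hkq : k / 2 = q + 1 := by omega
      refine ⟨W * (leadingConst (k - 2) * 2 ^ q + C₂ * (q / L₀)), ?_, fun X hX K hK => ?_⟩
      · have := leadingConst_nonneg (k - 2); positivity
      rw [if_pos hk, hkq]
      have h1 := hm₂ (B * X) (by nlinarith)
      have h2 := hlX X hX
      rw [hlBX X hX] at h1
      set l := Real.log X / Real.log x
      have hl0 : 0 < l := hL₀.trans_le h2
      have hc := leadingConst_nonneg (k - 2)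
      have h3 : (q : ℝ) * (l + β) ^ (q - 1) ≤ q / L₀ * (l + β) ^ q := by
        rcases q with _ | q
        · simp
        · rw [div_mul_eq_mul_div, le_div_iff₀ hL₀, Nat.add_sub_cancel, pow_succ, ← mul_assoc]
          exact mul_le_mul_of_nonneg_left (by linarith) (by positivity)
      have h4 : (l + β) ^ q ≤ (l + (2 * β + 1)) ^ q :=
        pow_le_pow_left₀ (by linarith) (by linarith) q
      have h5 : ((sumsUpTo R (k - 2) (B * X)).card : ℝ) ≤
          (leadingConst (k - 2) * 2 ^ q + C₂ * (q / L₀)) * (l + (2 * β + 1)) ^ q := by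
        calc _ ≤ _ := h1
          _ ≤ leadingConst (k - 2) * (2 * (l + β)) ^ q + C₂ * (q / L₀ * (l + β) ^ q) := by gcongr
          _ = (leadingConst (k - 2) * 2 ^ q + C₂ * (q / L₀)) * (l + β) ^ q := by
            rw [mul_pow]; ring
          _ ≤ _ := by gcongr
      have hK' : (K : ℝ) ≤ l + (2 * β + 1) := by linarith
      calc _ ≤ W * (l + (2 * β + 1)) *
            ((leadingConst (k - 2) * 2 ^ q + C₂ * (q / L₀)) * (l + (2 * β + 1)) ^ q) := by
            refine mul_le_mul (mul_le_mul_of_nonneg_left hK' (by positivity)) h5 (by positivity) ?_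
            have : 0 ≤ l + (2 * β + 1) := by linarith
            positivity
        _ = _ := by ring
    · exact ⟨0, le_rfl, fun X _ K _ => by simp [hk]⟩
  obtain ⟨C', hC', hstep⟩ := exists_upper_step (k / 2) (leadingConst_nonneg k) hC hA hD hL₀ hβ.le
  refine ⟨C', hC', fun X hX => ?_⟩
  have hl := hlX X hX
  have hX0 : 0 < X := by linarith
  have hlXB := hlBX X hX
  set l := Real.log X / Real.log x with hldef
  have hlβ : 0 ≤ l + β := by linarith
  have hK : ((⌊l + β⌋₊ + 1 : ℕ) : ℝ) ≤ l + β + 1 := by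
    push_cast; linarith [Nat.floor_le hlβ]
  have h1 := hrec X (⌊l + β⌋₊ + 1) hX0.le fun a ha => by
    refine Nat.lt_succ_of_le (Nat.le_floor ?_)
    rw [← hlXB, le_div_iff₀ hlx, ← Real.log_pow]
    exact Real.log_le_log (pow_pos hx0 a) ha
  have h2 := hlow X hX _ hK
  have h3 := hstep l hl _ hK
  have h4 : ∑ a ∈ Finset.range (⌊l + β⌋₊ + 1), 2 * ((sumsUpTo R k (B * x ^ a)).card : ℝ) ≤
      ∑ a ∈ Finset.range (⌊l + β⌋₊ + 1), 2 * (leadingConst k * (2 * (a + β)) ^ (k / 2) +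
        C * ((k / 2 : ℕ) * (a + β) ^ (k / 2 - 1))) := by
    refine Finset.sum_le_sum fun a _ => mul_le_mul_of_nonneg_left ?_ zero_le_two
    have := hmain (B * x ^ a) (by nlinarith [one_le_pow₀ hx.le (n := a)])
    rwa [log_mul_pow_div hx (by linarith)] at this
  have hk2 : (k + 1 + 1) / 2 = k / 2 + 1 := by omega
  rw [hk2, leadingConst_add_two, Nat.add_sub_cancel]
  have h5 : C' * l ^ (k / 2) ≤ C' * (((k / 2 + 1 : ℕ) : ℝ) * l ^ (k / 2)) := by
    refine mul_le_mul_of_nonneg_left (le_mul_of_one_le_left ?_ ?_) hC'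
    · exact pow_nonneg (by linarith) _
    · push_cast; linarith [Nat.cast_nonneg (α := ℝ) (k / 2)]
  linarith

theorem IsRealConj.exists_main_le_card (h : IsRealConj f τ η) (k : ℕ) :
    ∃ C : ℝ, 0 ≤ C ∧ ∀ X : ℝ, 2 ≤ X →
      leadingConst k * (2 * (Real.log X / Real.log (f η))) ^ (k / 2) -
        C * ((k / 2 : ℕ) * (Real.log X / Real.log (f η)) ^ (k / 2 - 1)) ≤
      ((sumsUpTo R k X).card : ℝ) := by
  have hx := h.one_lt
  have hx0 := h.pos
  have hlx : 0 < Real.log (f η) := Real.log_pos hx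
  induction k using Nat.twoStepInduction with
  | zero => exact ⟨0, le_rfl, fun X hX => by simp [card_sumsUpTo_zero h hX, leadingConst]⟩
  | one => exact ⟨0, le_rfl, fun X hX => by simp [card_sumsUpTo_one h hX, leadingConst]⟩
  | more k ih _ =>
  obtain ⟨D, hD, hrec⟩ := h.exists_le_card
  obtain ⟨C, hC, hmain⟩ := ih
  have hL₀ : 0 < Real.log 2 / Real.log (f η) := div_pos (Real.log_pos one_lt_two) hlx
  set x := f η with hxdef
  set L₀ := Real.log 2 / Real.log x with hL₀def
  set δ := Real.log D / Real.log x with hδdef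
  have hδ : 0 ≤ δ := div_nonneg (Real.log_nonneg hD) hlx.le
  obtain ⟨a₁, ha₁⟩ := pow_unbounded_of_one_lt (2 * D) hx
  obtain ⟨a₂, ha₂⟩ := exists_nat_ge (δ + 1)
  -- The first condition keeps x^a / D ≥ 2 for the induction hypothesis; the second gives the shift
  -- a₀ - δ ≥ 1 needed by `exists_lower_step`.
  obtain ⟨a₀, ha₀1, ha₀2⟩ : ∃ a₀ : ℕ, 2 * D ≤ x ^ a₀ ∧ δ + 1 ≤ a₀ :=
    ⟨max a₁ a₂, ha₁.le.trans (pow_le_pow_right₀ hx.le (le_max_left _ _)),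
      ha₂.trans (by exact_mod_cast le_max_right a₁ a₂)⟩
  set e₃ := Real.log 3 / Real.log x with he₃def
  have he₃ : 0 ≤ e₃ := div_nonneg (Real.log_nonneg (by norm_num)) hlx.le
  obtain ⟨C', hC', hstep⟩ := exists_lower_step (k / 2) (leadingConst_nonneg k) hC hL₀
    (show 0 ≤ e₃ + a₀ by positivity) (show 1 ≤ a₀ - δ by linarith)
  refine ⟨C', hC', fun X hX => ?_⟩
  have hX0 : 0 < X := by linarith
  have hl : L₀ ≤ Real.log X / Real.log x :=
    div_le_div_of_nonneg_right (Real.log_le_log two_pos hX) hlx.le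
  set l := Real.log X / Real.log x with hldef
  have hl0 : 0 < l := hL₀.trans_le hl
  obtain ⟨K, hK⟩ : ∃ K, K = ⌊l - e₃⌋₊ + 1 := ⟨_, rfl⟩
  have hK1 : l - e₃ ≤ K := by rw [hK]; push_cast; exact (Nat.lt_floor_add_one _).le
  have hK2 : (K : ℝ) ≤ l + 1 := by
    rw [hK]; push_cast
    have := Nat.floor_le_floor (show l - e₃ ≤ l by linarith)
    have h2 : ((⌊l - e₃⌋₊ : ℕ) : ℝ) ≤ ⌊l⌋₊ := by exact_mod_cast this
    linarith [Nat.floor_le hl0.le]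
  have ha₀pos : 1 ≤ a₀ := by
    have : (1 : ℝ) ≤ a₀ := by linarith
    exact_mod_cast this
  have h1 := hrec k X a₀ K (by linarith) fun a ha haK => by
    have hale : (a : ℝ) ≤ l - e₃ := by
      -- If l < e₃, the floor is 0 and K = 1, so no a with 1 ≤ a₀ ≤ a < K exists.
      have h0 : 0 ≤ l - e₃ := by
        by_contra hneg
        rw [Nat.floor_of_nonpos (by linarith)] at hK
        omega
      exact (Nat.le_floor_iff h0).1 (by omega)
    rw [← Real.log_le_log_iff (by positivity) hX0, Real.log_mul (by norm_num) (by positivity),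
      Real.log_pow]
    have h3 : e₃ * Real.log x = Real.log 3 := div_mul_cancel₀ _ hlx.ne'
    have h4 : l * Real.log x = Real.log X := div_mul_cancel₀ _ hlx.ne'
    nlinarith
  have hM1 : ((K - a₀ : ℕ) : ℝ) ≤ l + 1 := le_trans (by exact_mod_cast Nat.sub_le K a₀) hK2
  have hM2 : l - (e₃ + a₀) ≤ ((K - a₀ : ℕ) : ℝ) := by
    have : (K : ℝ) ≤ ((K - a₀ : ℕ) : ℝ) + a₀ := by
      exact_mod_cast (by omega : K ≤ K - a₀ + a₀)
    linarith
  have h2 := hstep l hl _ hM1 hM2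
  rw [Finset.sum_Ico_eq_sum_range] at h1
  have h3 : ∑ a ∈ Finset.range (K - a₀), 2 * (leadingConst k * (2 * (a + (a₀ - δ))) ^ (k / 2) -
        C * ((k / 2 : ℕ) * (a + (a₀ - δ)) ^ (k / 2 - 1))) ≤
      ∑ a ∈ Finset.range (K - a₀), 2 * ((sumsUpTo R k (x ^ (a₀ + a) / D)).card : ℝ) := by
    refine Finset.sum_le_sum fun a _ => mul_le_mul_of_nonneg_left ?_ zero_le_two
    have h4 : 2 ≤ x ^ (a₀ + a) / D := by
      rw [le_div_iff₀ (by linarith)]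
      exact ha₀1.trans (pow_le_pow_right₀ hx.le (by omega))
    have h5 := hmain _ h4
    have h6 : Real.log (x ^ (a₀ + a) / D) / Real.log x = a + (a₀ - δ) := by
      rw [div_eq_inv_mul (x ^ (a₀ + a)), log_mul_pow_div hx (by positivity), Real.log_inv, neg_div]
      push_cast; ring
    rwa [h6] at h5
  have hk2 : (k + 2) / 2 = k / 2 + 1 := by omega
  rw [hk2, leadingConst_add_two, Nat.add_sub_cancel]
  have h5 : C' * l ^ (k / 2) ≤ C' * (((k / 2 + 1 : ℕ) : ℝ) * l ^ (k / 2)) := by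
    refine mul_le_mul_of_nonneg_left (le_mul_of_one_le_left ?_ ?_) hC'
    · exact pow_nonneg hl0.le _
    · push_cast; linarith [Nat.cast_nonneg (α := ℝ) (k / 2)]
  linarith

/-- The asymptotic formula with its error term, for an abstract real quadratic ring. -/
theorem IsRealConj.exists_abs_card_sub_le (h : IsRealConj f τ η) (k : ℕ) :
    ∃ C : ℝ, ∀ X : ℝ, 2 ≤ X → |((sumsUpTo R k X).card : ℝ) -
      leadingConst k * (2 * Real.log X / Real.log (f η)) ^ (k / 2)| ≤
        C * Real.log X ^ (((k / 2 : ℕ) : ℤ) - 1) := by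
  obtain ⟨C₁, hC₁, h₁⟩ := h.exists_card_le_main k
  obtain ⟨C₂, hC₂, h₂⟩ := h.exists_main_le_card k
  have hlx : 0 < Real.log (f η) := Real.log_pos h.one_lt
  set p := k / 2 with hp
  refine ⟨max C₁ C₂ * (p / Real.log (f η) ^ (p - 1)), fun X hX => ?_⟩
  have hlX : 0 < Real.log X := Real.log_pos (by linarith)
  have e1 : max C₁ C₂ * (p / Real.log (f η) ^ (p - 1)) * Real.log X ^ ((p : ℤ) - 1) =
      max C₁ C₂ * (p * (Real.log X / Real.log (f η)) ^ (p - 1)) := by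
    -- For p = 0 the integer exponent is -1 but the natural one is 0; the factor p makes both sides
    -- zero.
    rcases p with _ | p
    · simp
    · have : ((p + 1 : ℕ) : ℤ) - 1 = (p : ℕ) := by push_cast; ring
      rw [this, zpow_natCast, Nat.add_sub_cancel, div_pow]; ring
  have hnn : 0 ≤ (p : ℝ) * (Real.log X / Real.log (f η)) ^ (p - 1) := by positivity
  have h3 := mul_le_mul_of_nonneg_right (le_max_left C₁ C₂) hnn
  have h4 := mul_le_mul_of_nonneg_right (le_max_right C₁ C₂) hnn
  rw [e1, mul_div_assoc, abs_le]
  constructor <;> linarith [h₁ X hX, h₂ X hX]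

end Asymptotics
-- Real quadratic fields as an instance of the abstract setting
section NumberField

variable (L : Type*) [Field L] [NumberField L]

theorem countUnitSums_eq_card (k : ℕ) (X : ℝ) :
    countUnitSums L k X = (sumsUpTo (𝓞 L) k X).card := by
  rw [countUnitSums, ← Set.ncard_coe_finset]
  congr 1
  ext n
  rw [Finset.mem_coe, mem_sumsUpTo]
  rfl

variable {L}

/-- The nontrivial automorphism of a quadratic field. -/
theorem exists_conj (hL : Module.finrank ℚ L = 2) :
    ∃ τ : L ≃ₐ[ℚ] L, (∀ z, τ (τ z) = z) ∧ ∀ z, τ z = z → ∃ q : ℚ, algebraMap ℚ L q = z := by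
  have : Algebra.IsQuadraticExtension ℚ L := ⟨hL⟩
  have hcard : Nat.card Gal(L/ℚ) = 2 := by rw [IsGalois.card_aut_eq_finrank, hL]
  obtain ⟨τ, hτ, huniv⟩ := (Nat.card_eq_two_iff' (1 : Gal(L/ℚ))).1 hcard
  refine ⟨τ, fun z => ?_, fun z hz => ?_⟩
  · have : τ * τ = 1 := by
      by_contra hne
      have := huniv _ hne
      exact hτ (mul_eq_left.1 this)
    simpa using congrArg (fun g : Gal(L/ℚ) => g z) this
  · refine (IsGalois.mem_range_algebraMap_iff_fixed z).2 fun g => ?_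
    by_cases hg : g = 1
    · rw [hg]; rfl
    · rw [huniv g hg]; exact hz

theorem exists_int_of_algebraMap_rat (z : 𝓞 L) (q : ℚ) (hq : algebraMap ℚ L q = z) :
    ∃ n : ℤ, (n : 𝓞 L) = z := by
  have hint : IsIntegral ℤ (algebraMap ℚ L q) := hq ▸ z.2
  have hint' : IsIntegral ℤ q := (isIntegral_algebraMap_iff (algebraMap ℚ L).injective).1 hint
  obtain ⟨n, hn⟩ := IsIntegrallyClosed.isIntegral_iff.1 hint'
  refine ⟨n, NumberField.RingOfIntegers.ext ?_⟩
  rw [← hq, ← hn]; simp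

/-- The norms of η and η⁻¹ are rational integers with product 1, hence ±1. -/
theorem exists_isRealConj (hL : Module.finrank ℚ L = 2) (σ : L →+* ℝ) (η : (𝓞 L)ˣ)
    (hη : IsFundamentalUnit η) (h1 : 1 < σ ((η : 𝓞 L) : L)) :
    ∃ τ : 𝓞 L →+* 𝓞 L, IsRealConj (σ.comp (algebraMap (𝓞 L) L)) τ η := by
  obtain ⟨τ, hinv, hfix⟩ := exists_conj hL
  let τ' : 𝓞 L →+* 𝓞 L := NumberField.RingOfIntegers.mapRingHom (τ : L →+* L)
  have hinv' : ∀ z, τ' (τ' z) = z := fun z => NumberField.RingOfIntegers.ext (hinv z)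
  have hfix' : ∀ z, τ' z = z → ∃ n : ℤ, (n : 𝓞 L) = z := fun z hz => by
    obtain ⟨q, hq⟩ := hfix z (congrArg (fun w : 𝓞 L => (w : L)) hz)
    exact exists_int_of_algebraMap_rat z q hq
  have hnorm : ∀ u : (𝓞 L)ˣ, ∃ n : ℤ, (n : 𝓞 L) = u * τ' u := fun u =>
    hfix' _ (by rw [map_mul, hinv', mul_comm])
  refine ⟨τ', σ.injective.comp NumberField.RingOfIntegers.coe_injective, h1, hη, hinv', hfix', ?_⟩
  obtain ⟨m, hm⟩ := hnorm η
  obtain ⟨n, hn⟩ := hnorm η⁻¹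
  have hmn : m * n = 1 := by
    have h2 : ((m * n : ℤ) : 𝓞 L) = 1 := by
      push_cast
      rw [hm, hn, mul_mul_mul_comm, ← map_mul, Units.mul_inv, map_one, mul_one]
    exact_mod_cast h2
  rw [← hm]
  rcases Int.eq_one_or_neg_one_of_mul_eq_one hmn with rfl | rfl <;> simp

/-- A real embedding determines the fundamental unit. -/
theorem map_le_map_of_isFundamentalUnit (σ : L →+* ℝ) {η ε : (𝓞 L)ˣ} (hη : IsFundamentalUnit η)
    (h1 : 1 < σ ((η : 𝓞 L) : L)) (h2 : 1 < σ ((ε : 𝓞 L) : L)) :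
    σ ((η : 𝓞 L) : L) ≤ σ ((ε : 𝓞 L) : L) := by
  obtain ⟨n, hn⟩ := hη ε
  have hs := (IsSignedPow.mk_unit hn).abs_map (f := σ.comp (algebraMap (𝓞 L) L))
    (zero_lt_one.trans h1)
  have hs' : σ ((ε : 𝓞 L) : L) = σ ((η : 𝓞 L) : L) ^ n := by
    rw [← abs_of_pos (zero_lt_one.trans h2)]; exact hs
  have hn1 : 1 ≤ n := by
    by_contra hlt
    have := zpow_le_one_of_nonpos₀ h1.le (show n ≤ 0 by omega)
    linarith
  rw [hs']
  simpa using zpow_le_zpow_right₀ h1.le hn1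

end NumberField

end SumsOfUnits

theorem theorem1 (L : Type*) [Field L] [NumberField L] (hL : Module.finrank ℚ L = 2)
    (σ : L →+* ℝ) (k : ℕ) (hk : 1 ≤ k) :
    ∃ C : ℝ, ∀ η : (𝓞 L)ˣ, SumsOfUnits.IsFundamentalUnit η → 1 < σ ((η : 𝓞 L) : L) →
      ∀ X : ℝ, 2 ≤ X →
        |(SumsOfUnits.countUnitSums L k X : ℝ) -
            SumsOfUnits.leadingConst k *
              (2 * Real.log X / Real.log (σ ((η : 𝓞 L) : L))) ^ (k / 2 : ℕ)|
          ≤ C * (Real.log X) ^ (((k / 2 : ℕ) : ℤ) - 1) := by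
  -- The constant is chosen before η. This is harmless because any two admissible η have the same
  -- image under σ.
  by_cases hex : ∃ η : (𝓞 L)ˣ, SumsOfUnits.IsFundamentalUnit η ∧ 1 < σ ((η : 𝓞 L) : L)
  · obtain ⟨ε, hε, hε1⟩ := hex
    obtain ⟨τ, hτ⟩ := SumsOfUnits.exists_isRealConj hL σ ε hε hε1
    obtain ⟨C, hC⟩ := hτ.exists_abs_card_sub_le k
    refine ⟨C, fun η hη hη1 X hX => ?_⟩
    have heq : σ ((η : 𝓞 L) : L) = σ ((ε : 𝓞 L) : L) :=
      le_antisymm (SumsOfUnits.map_le_map_of_isFundamentalUnit σ hη hη1 hε1)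
        (SumsOfUnits.map_le_map_of_isFundamentalUnit σ hε hε1 hη1)
    rw [heq, SumsOfUnits.countUnitSums_eq_card]
    exact hC X hX
  · exact ⟨0, fun η hη hη1 => absurd ⟨η, hη, hη1⟩ hex⟩
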